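/- **Generator model.** Let $T\in\mathbb{N}$ be the number of periods, $[a,b]_{\mathbb Z}$ the set of integers from $a$ to $b$ (empty if $a>b$), and $\Lambda$ a finite set of generators, each on at the beginning of the horizon. A generator has a minimum up time $L\ge 1$, a minimum down time $\ell\ge 1$, has been on for $s_0\ge 0$ periods (put $t_0=\max\{L-s_0,0\}$, so that it cannot shut down before period $t_0+1$), generation bounds $\underline P,\overline P$, start-up/shut-down ramp rate $\overline V$, ramp rate $V$, start-up costs $S(\cdot)$ and shut-down costs $S'(\cdot)$ depending on the number of periods off, respectively on, and in period $s$ the convex piecewise linear generation cost $x\mapsto\max_{1\le i\le N}(a_i^s x+b_i^s)$ with $N\ge1$. Let $\mathcal{TK}^1=\{(1,k):k\in[\max\{t_0,1\},T]_{\mathbb Z}\}$, $\mathcal{TK}^2=\{(t,k): t\in[t_0+\ell+1,T]_{\mathbb Z},\ k\in[\min\{t+L-1,T\},T]_{\mathbb Z}\}$ (possible first and later on-intervals), $\mathcal{TK}=\mathcal{TK}^1\cup\mathcal{TK}^2$, and $\mathcal{KT}=\{(k,t):k\in[t_0,T-\ell-1]_{\mathbb Z},\ t\in[k+\ell+1,T]_{\mathbb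 Z}\}$. For $(t,k)\in\mathcal{TK}$ write $p_{tk}=w_k$ if $(t,k)\in\mathcal{TK}^1$ and $p_{tk}=y_{tk}$ if $(t,k)\in\mathcal{TK}^2$. The region $\mathcal X_I$ of the generator (EUC formulation) is the set of all real $(w,\psi,\theta,y,z,q)$ with $$\begin{aligned} &\textstyle\sum_{t=t_0}^T w_t=1,\\ &\textstyle -w_t+\sum_{k=t+\ell+1}^{T}z_{tk}-\sum_{k=t_0+\ell+1}^{t-L+1}y_{kt}+\theta_t=0 && t\in[t_0,T-1]_{\mathbb Z},\\ &\textstyle\sum_{k=\min\{t+L-1,T\}}^{T}y_{tk}-\sum_{k=t_0}^{t-\ell-1}z_{kt}=0 && t\in[t_0+\ell+1,T]_{\mathbb Z},\\ &\underline P\,p_{tk}\le q_{tk}^s\le\overline P\,p_{tk},\quad \psi_{tk}^s\ge a_i^s q_{tk}^s+b_i^s p_{tk} && s\in[t,k]_{\mathbb Z},\ i\in[1,N]_{\mathbb Z},\ (t,k)\in\mathcal{TK},\\ &|q_{tk}^{s}-q_{tk}^{s-1}|\le V p_{tk} && s\in[t+1,k]_{\mathbb Z},\ (t,k)\in\mathcal{TK},\\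 &q_{tk}^t\le\overline V p_{tk}\ \ ((t,k)\in\mathcal{TK}^2), \quad q_{tk}^k\le\overline V p_{tk}\ \ ((t,k)\in\mathcal{TK},\ k\le T-1),\\ &w,y,z\ge0,\quad \theta_t\ge0 && t\in[t_0,T-\ell-1]_{\mathbb Z}. \end{aligned}$$ Its cost is $$g=\sum_{t=t_0}^{T-1}S'(t+s_0)w_t+\sum_{t=t_0+\ell+1}^{T-L}\ \sum_{k=t+L-1}^{T-1}S'(k-t+1)y_{tk}+\sum_{(k,t)\in\mathcal{KT}}S(t-k-1)z_{kt}+\sum_{(t,k)\in\mathcal{TK}}\sum_{s=t}^k\psi_{tk}^s ,$$ and its output in period $s$ is $\sum_{(t,k)\in\mathcal{TK},\,t\le s\le k}q_{tk}^s$. All data may depend on the generator $j\in\Lambda$; write $\mathcal X_I^j$, $g_j$, and $Q_j(x_j)\in\mathbb R^T$ for the output vector of a plan $x_j$. **System problem and prices.** For a load $d\in\mathbb R^T$, the problem MEUC is to minimize $\sum_j g_j(x_j)$ subject to the load balance $\sum_j Q_j(x_j)=d$, $x_j\in\mathcal X_I^j$ and $w^j,y^j,z^j$ binary for all $j\in\Lambda$.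 Its LP relaxation drops the binary restrictions. For a price vector $\pi\in\mathbb R^T$ let $v_j(\pi)$ be the maximum of $\pi^{T}Q_j(x)-g_j(x)$ over all $x\in\mathcal X_I^j$ with $w,y,z$ binary. An *optimal convex hull price* is a vector $\pi$ that maximizes $\pi^{T}d-\sum_j v_j(\pi)$, the Lagrangian dual function of MEUC with load balance dualized. For an optimal solution $\bar x$ of MEUC the total uplift payment is $U(\pi,\bar x)=\sum_j\big(v_j(\pi)-(\pi^{T}Q_j(\bar x_j)-g_j(\bar x_j))\big)$. A vector $\pi$ consists of *dual values of the load-balance constraints* if it is the load-balance part of an optimal solution of the dual linear program of the LP relaxation. **Theorem.** Suppose that the LP relaxation of MEUC is feasible. Then: 1. The LP relaxation has an optimal solution, its dual linear program has an optimal solution, and every maximum $v_j(\pi)$ is attained. 2. A vector $\pi\in\mathbb R^T$ is an optimal convex hull price if and only if it consists of dual values of the load-balance constraints of the LP relaxation; and the maximum of $\pi^{T}d-\sum_j v_j(\pi)$ over $\pi$ is the optimal value $Z^*_{QP}$ of the LP relaxation. 3. If MEUC is feasible, it has an optimal solution. For every optimal solution $\bar x$ of MEUC, a vector $\pi$ minimizes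 the total uplift payment $U(\cdot,\bar x)$ over $\mathbb R^T$ if and only if it consists of dual values of the load-balance constraints of the LP relaxation, and the minimum is $Z^*_{QIP}-Z^*_{QP}$, where $Z^*_{QIP}$ is the optimal value of MEUC. -/

import Mathlib

open Finset BigOperators

noncomputable section

namespace UnitCommitment

/-! ## Linear programs and their duals -/

/-- A linear program in minimization form: minimize `cost x` subject to
`ineqRhs i ≤ ineq i x` for all `i`, and `eqn k x = eqnRhs k` for all `k`. -/
structure LinProg (E ι κ : Type*) [AddCommGroup E] [Module ℝ E] where
  cost : E →ₗ[ℝ] ℝ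
  ineq : ι → E →ₗ[ℝ] ℝ
  ineqRhs : ι → ℝ
  eqn : κ → E →ₗ[ℝ] ℝ
  eqnRhs : κ → ℝ

namespace LinProg

variable {E ι κ : Type*} [AddCommGroup E] [Module ℝ E]

/-- The feasible set. -/
def feasible (P : LinProg E ι κ) : Set E :=
  {x | (∀ i, P.ineqRhs i ≤ P.ineq i x) ∧ ∀ k, P.eqn k x = P.eqnRhs k}

/-- `x` is an optimal solution. -/
def IsOptimal (P : LinProg E ι κ) (x : E) : Prop :=
  x ∈ P.feasible ∧ ∀ x' ∈ P.feasible, P.cost x ≤ P.cost x'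

variable [Fintype ι] [Fintype κ]

/-- Feasibility in the dual linear program: nonnegative multipliers `lam` of the inequalities and
free multipliers `mu` of the equations that combine the constraints to the objective. -/
def DualFeasible (P : LinProg E ι κ) (lam : ι → ℝ) (mu : κ → ℝ) : Prop :=
  (∀ i, 0 ≤ lam i) ∧ ∑ i, lam i • P.ineq i + ∑ k, mu k • P.eqn k = P.cost

/-- The objective of the dual linear program (to be maximized). -/
def dualObj (P : LinProg E ι κ) (lam : ι → ℝ) (mu : κ → ℝ) : ℝ :=
  ∑ i, lam i * P.ineqRhs i + ∑ k, mu k * P.eqnRhs k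

/-- `(lam, mu)` is an optimal solution of the dual linear program. -/
def IsDualOptimal (P : LinProg E ι κ) (lam : ι → ℝ) (mu : κ → ℝ) : Prop :=
  P.DualFeasible lam mu ∧
    ∀ lam' mu', P.DualFeasible lam' mu' → P.dualObj lam' mu' ≤ P.dualObj lam mu

end LinProg

/-! ## A single generator -/

/-- The data of a generator that is on at the beginning of the horizon. -/
structure Generator where
  /-- minimum up time -/
  L : ℕ
  /-- minimum down time -/
  ℓ : ℕ
  /-- number of periods for which the generator has been on before period `1` -/
  s₀ : ℕ
  /-- lower bound of the generation amount of a unit that is on -/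
  Pmin : ℝ
  /-- upper bound of the generation amount of a unit that is on -/
  Pmax : ℝ
  /-- start-up and shut-down ramp rate -/
  Vbar : ℝ
  /-- ramp-up and ramp-down rate between periods in which the unit is on -/
  V : ℝ
  /-- `S n` is the cost of a start-up after `n` periods off -/
  S : ℕ → ℝ
  /-- `S' n` is the cost of a shut-down after `n` periods on -/
  S' : ℕ → ℝ
  /-- number of linear pieces of the generation cost -/
  N : ℕ
  /-- slopes: the cost of generating `x` in period `s` is the maximum over `i` of
  `a i s * x + b i s` -/
  a : Fin N → ℕ → ℝ
  /-- intercepts -/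
  b : Fin N → ℕ → ℝ
  L_pos : 1 ≤ L
  ℓ_pos : 1 ≤ ℓ
  N_pos : 1 ≤ N

/-- The variables of the extended formulation. The coordinates whose indices lie outside the index
sets below occur neither in a constraint nor in an objective. -/
inductive Var where
  /-- the first shut-down is at time `t + 1` (for `t = T`: the unit stays on throughout) -/
  | w (t : ℕ)
  /-- start-up at `t`, next shut-down at `k + 1` (for `k = T`: on till the end) -/
  | y (t k : ℕ)
  /-- shut-down at `k + 1`, next start-up at `t` -/
  | z (k t : ℕ)
  /-- shut-down at `t + 1` and off till the end -/
  | θ (t : ℕ)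
  /-- generation amount in period `s` of the on-interval `[t, k]` -/
  | q (t k s : ℕ)
  /-- generation cost in period `s` of the on-interval `[t, k]` -/
  | φ (t k s : ℕ)

/-- A value for every variable of one generator. -/
abbrev Plan := Var → ℝ

/-- The variable `v` as a linear functional. -/
abbrev coord (v : Var) : Plan →ₗ[ℝ] ℝ := LinearMap.proj v

namespace Generator

variable (G : Generator) (T : ℕ)

/-- `t₀ = [L - s₀]⁺` (truncated subtraction): the earliest shut-down time is `t₀ + 1`. -/
def t₀ : ℕ := G.L - G.s₀

/-- The possible (nonempty) first on-intervals `[1, k]`. -/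
def firstOn : Finset (ℕ × ℕ) := {1} ×ˢ Icc (max G.t₀ 1) T

/-- The possible later on-intervals `[t, k]`. -/
def laterOn : Finset (ℕ × ℕ) :=
  {p ∈ Icc (G.t₀ + G.ℓ + 1) T ×ˢ range (T + 1) | min (p.1 + G.L - 1) T ≤ p.2}

/-- All possible on-intervals `[t, k]`. -/
def onIntervals : Finset (ℕ × ℕ) := G.firstOn T ∪ G.laterOn T

/-- The pairs `(k, t)` such that the unit may shut down at `k + 1` and start up again at `t`. -/
def offIntervals : Finset (ℕ × ℕ) :=
  {p ∈ Icc G.t₀ T ×ˢ range (T + 1) | p.1 + G.ℓ + 1 ≤ p.2}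

/-- The variable that indicates whether `[t, k]` is an on-interval of the schedule: `w k` for a
first one and `y t k` for a later one. -/
def status (p : ℕ × ℕ) : Plan →ₗ[ℝ] ℝ :=
  if p ∈ G.firstOn T then coord (.w p.2) else coord (.y p.1 p.2)

/-- The inequalities of the extended formulation. -/
inductive Ineq where
  | genLower (p : G.onIntervals T) (s : Icc p.1.1 p.1.2)
  | genUpper (p : G.onIntervals T) (s : Icc p.1.1 p.1.2)
  | startRamp (p : G.laterOn T)
  | stopRamp (p : {p ∈ G.onIntervals T | p.2 < T})
  | rampDown (p : G.onIntervals T) (s : Icc (p.1.1 + 1) p.1.2)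
  | rampUp (p : G.onIntervals T) (s : Icc (p.1.1 + 1) p.1.2)
  | genCost (p : G.onIntervals T) (s : Icc p.1.1 p.1.2) (i : Fin G.N)
  | wNonneg (t : Icc G.t₀ T)
  | yNonneg (p : G.laterOn T)
  | zNonneg (p : G.offIntervals T)
  | θNonneg (t : Ico G.t₀ (T - G.ℓ))
  deriving Fintype

/-- The inequality with index `c` reads `0 ≤ G.ineq T c x`. -/
def ineq : G.Ineq T → Plan →ₗ[ℝ] ℝ
  | .genLower p s => coord (.q p.1.1 p.1.2 s) - G.Pmin • G.status T p
  | .genUpper p s => G.Pmax • G.status T p - coord (.q p.1.1 p.1.2 s)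
  | .startRamp p => G.Vbar • G.status T p - coord (.q p.1.1 p.1.2 p.1.1)
  | .stopRamp p => G.Vbar • G.status T p - coord (.q p.1.1 p.1.2 p.1.2)
  | .rampDown p s =>
      G.V • G.status T p - (coord (.q p.1.1 p.1.2 (s - 1)) - coord (.q p.1.1 p.1.2 s))
  | .rampUp p s =>
      G.V • G.status T p - (coord (.q p.1.1 p.1.2 s) - coord (.q p.1.1 p.1.2 (s - 1)))
  | .genCost p s i =>
      coord (.φ p.1.1 p.1.2 s) - G.a i s • coord (.q p.1.1 p.1.2 s) - G.b i s • G.status T p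
  | .wNonneg t => coord (.w t)
  | .yNonneg p => coord (.y p.1.1 p.1.2)
  | .zNonneg p => coord (.z p.1.1 p.1.2)
  | .θNonneg t => coord (.θ t)

/-- The equations of the extended formulation: there is one first shut-down (or none, `w T = 1`),
and the flow is balanced at the shut-downs and at the start-ups. -/
inductive Eqn where
  | total
  | shutDown (t : Ico G.t₀ T)
  | startUp (t : Icc (G.t₀ + G.ℓ + 1) T)
  deriving Fintype

/-- The left-hand sides of the equations. -/
def eqn : G.Eqn T → Plan →ₗ[ℝ] ℝ
  | .total => ∑ t ∈ Icc G.t₀ T, coord (.w t)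
  | .shutDown t =>
      -coord (.w t) + ∑ k ∈ Icc (t + G.ℓ + 1) T, coord (.z t k)
        - ∑ k ∈ Icc (G.t₀ + G.ℓ + 1) (t + 1 - G.L), coord (.y k t) + coord (.θ t)
  | .startUp t =>
      ∑ k ∈ Icc (min (t + G.L - 1) T) T, coord (.y t k)
        - ∑ k ∈ Icc G.t₀ (t - G.ℓ - 1), coord (.z k t)

/-- The right-hand sides of the equations. -/
def eqnRhs : G.Eqn T → ℝ
  | .total => 1
  | .shutDown _ => 0
  | .startUp _ => 0

/-- The feasible region of the extended formulation, without integrality restrictions. -/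
def region : Set Plan :=
  {x | (∀ c, 0 ≤ G.ineq T c x) ∧ ∀ c, G.eqn T c x = G.eqnRhs T c}

/-- The integrality restrictions: `w`, `y` and `z` are binary. -/
def IsBinary (x : Plan) : Prop :=
  (∀ t ∈ Icc G.t₀ T, x (.w t) = 0 ∨ x (.w t) = 1) ∧
  (∀ p ∈ G.laterOn T, x (.y p.1 p.2) = 0 ∨ x (.y p.1 p.2) = 1) ∧
  (∀ p ∈ G.offIntervals T, x (.z p.1 p.2) = 0 ∨ x (.z p.1 p.2) = 1)

/-- The total cost: shut-down, start-up and generation costs. -/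
def cost : Plan →ₗ[ℝ] ℝ :=
  ∑ t ∈ Ico G.t₀ T, G.S' (t + G.s₀) • coord (.w t)
    + ∑ t ∈ Icc (G.t₀ + G.ℓ + 1) (T - G.L), ∑ k ∈ Ico (t + G.L - 1) T,
        G.S' (k - t + 1) • coord (.y t k)
    + ∑ p ∈ G.offIntervals T, G.S (p.2 - p.1 - 1) • coord (.z p.1 p.2)
    + ∑ p ∈ G.onIntervals T, ∑ s ∈ Icc p.1 p.2, coord (.φ p.1 p.2 s)

/-- The generation amount in period `s`. -/
def output (s : ℕ) : Plan →ₗ[ℝ] ℝ :=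
  ∑ p ∈ G.onIntervals T with p.1 ≤ s ∧ s ≤ p.2, coord (.q p.1 p.2 s)

end Generator

/-! ## The system and its prices -/

/-- The periods `1, …, T`. -/
abbrev Period (T : ℕ) := Icc 1 T

/-- The profit of a generator with plan `x` under the prices `π`. -/
def Generator.profit (G : Generator) (T : ℕ) (π : Period T → ℝ) (x : Plan) : ℝ :=
  ∑ s, π s * G.output T s x - G.cost T x

/-- The profits a generator can reach on its own (with binary commitment decisions). -/
def Generator.profits (G : Generator) (T : ℕ) (π : Period T → ℝ) : Set ℝ :=
  G.profit T π '' {x | x ∈ G.region T ∧ G.IsBinary T x}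

/-- The maximum profit `v(π)` of a generator (with binary commitment decisions). -/
def Generator.maxProfit (G : Generator) (T : ℕ) (π : Period T → ℝ) : ℝ :=
  sSup (G.profits T π)

variable {J : Type*} [Fintype J] (G : J → Generator) (T : ℕ) (d : Period T → ℝ)

/-- The linear programming relaxation of the system problem: the total cost of all generators is
minimized over the product of their regions, subject to load balance in each period. -/
def systemLP : LinProg (J → Plan) (Σ j, (G j).Ineq T) (Period T ⊕ Σ j, (G j).Eqn T) where
  cost := ∑ j, (G j).cost T ∘ₗ LinearMap.proj j
  ineq := fun c => (G c.1).ineq T c.2 ∘ₗ LinearMap.proj c.1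
  ineqRhs := fun _ => 0
  eqn := Sum.elim (fun s => ∑ j, (G j).output T s ∘ₗ LinearMap.proj j)
    (fun c => (G c.1).eqn T c.2 ∘ₗ LinearMap.proj c.1)
  eqnRhs := Sum.elim d (fun c => (G c.1).eqnRhs T c.2)

/-- `π` consists of dual values of the load-balance constraints: it is the load-balance part of an
optimal solution of the dual of the linear programming relaxation. -/
def IsLoadBalanceDual (π : Period T → ℝ) : Prop :=
  ∃ lam mu, (systemLP G T d).IsDualOptimal lam mu ∧ ∀ s, mu (Sum.inl s) = π s

/-- The feasible schedules of the system operator (with binary commitment decisions). -/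
def schedules : Set (J → Plan) :=
  {x | x ∈ (systemLP G T d).feasible ∧ ∀ j, (G j).IsBinary T (x j)}

/-- The total cost of a schedule. -/
def totalCost (x : J → Plan) : ℝ := ∑ j, (G j).cost T (x j)

/-- `x` is an optimal schedule of the system operator. -/
def IsOptimalSchedule (x : J → Plan) : Prop :=
  x ∈ schedules G T d ∧ ∀ x' ∈ schedules G T d, totalCost G T x ≤ totalCost G T x'

/-- The total uplift payment if the prices are `π` and the generators follow the schedule `x`: the
sum of their lost opportunity costs. -/
def totalUplift (π : Period T → ℝ) (x : J → Plan) : ℝ :=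
  ∑ j, ((G j).maxProfit T π - (G j).profit T π (x j))

/-- `π` minimizes the total uplift payment for the schedule `x`. -/
def MinimizesUplift (x : J → Plan) (π : Period T → ℝ) : Prop :=
  ∀ π', totalUplift G T π x ≤ totalUplift G T π' x

/-- The Lagrangian dual function of the system problem with binary commitment decisions, where the
load-balance constraints are dualized with multipliers `π`. -/
def lagrangianDual (π : Period T → ℝ) : ℝ :=
  ∑ s, π s * d s - ∑ j, (G j).maxProfit T π

/-- `π` is an optimal convex hull price: it maximizes the Lagrangian dual function. -/
def IsConvexHullPrice (π : Period T → ℝ) : Prop :=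
  ∀ π', lagrangianDual G T d π' ≤ lagrangianDual G T d π

end UnitCommitment

end

/-! The core is integrality of a single generator's problem: for every price vector, maximizing
profit over the relaxed region and over its binary points gives the same value. The equations say
that `w`, `y`, `z`, `θ` form a unit flow from the node `total` to a sink in a network that is
acyclic because arcs go forward in time. The support of an optimal relaxed plan therefore contains a
binary unit flow (`exists_binary_flow`). Scaling each generation variable by the ratio of new to old
status multiplies every inequality, all of which have right-hand side zero, by a nonnegative factor.
So tight inequalities stay tight, and complementary slackness makes the binary plan optimal
(`exists_isOptimal_isBinary`).

Hence `maxProfit` is a linear programming value. Once the load-balance multipliers are fixed at `π`,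
the dual of the system LP splits into one dual per generator, and its best value is `lagrangianDual`
at `π` (`dualObj_le_lagrangianDual`, `exists_dualFeasible_eq_lagrangianDual`). Maximizing over `π`
gives the LP value, at exactly the load-balance duals. The uplift of a schedule is its cost minus
the Lagrangian dual, so it has the same optimal prices.

Duality and attainment rest on an algebraic Farkas lemma, valid for the infinite-dimensional space
`Plan`. -/

noncomputable section

namespace UnitCommitment

/-! ## Duality of linear programs over arbitrary real vector spaces -/

section Farkas

variable {E ι κ : Type*} [AddCommGroup E] [Module ℝ E]

/-- Farkas' lemma for a finite family of linear functionals. -/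
theorem exists_nonneg_sum_smul_eq_of_finset (s : Finset ι) :
    ∀ (a : ι → E →ₗ[ℝ] ℝ) (b : E →ₗ[ℝ] ℝ), (∀ x, (∀ i ∈ s, 0 ≤ a i x) → 0 ≤ b x) →
      ∃ lam : ι → ℝ, (∀ i, 0 ≤ lam i) ∧ ∑ i ∈ s, lam i • a i = b := by
  classical
  induction s using Finset.induction_on with
  | empty =>
    intro a b h
    refine ⟨fun _ => 0, fun _ => le_rfl, ?_⟩
    ext x
    have h1 := h x (by simp)
    have h2 := h (-x) (by simp)
    rw [map_neg] at h2
    simpa using (by linarith : (0 : ℝ) = b x)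
  | insert j s hj ih =>
    intro a b h
    by_cases hb : ∀ x, (∀ i ∈ s, 0 ≤ a i x) → 0 ≤ b x
    · obtain ⟨lam, hlam, hsum⟩ := ih a b hb
      refine ⟨fun i => if i = j then 0 else lam i, fun i => ?_, ?_⟩
      · dsimp only
        split_ifs
        exacts [le_rfl, hlam i]
      · rw [sum_insert hj]
        dsimp only
        rw [if_pos rfl, zero_smul, zero_add, ← hsum]
        refine sum_congr rfl fun i hi => ?_
        rw [if_neg (ne_of_mem_of_not_mem hi hj)]
    -- If the functionals in `s` do not suffice, a point `x₀` witnesses this, and `a j` must be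
    -- negative there. After normalizing to `a j x₁ = -1`, the map `x ↦ x + a j x • x₁` projects
    -- onto the kernel of `a j`; induction applies to the functionals pulled back along it.
    · push Not at hb
      obtain ⟨x₀, hx₀, hbx₀⟩ := hb
      have hj₀ : a j x₀ < 0 := by
        by_contra hcon
        refine absurd (h x₀ fun i hi => ?_) (not_le.2 hbx₀)
        rcases mem_insert.1 hi with rfl | hi
        exacts [not_lt.1 hcon, hx₀ i hi]
      set x₁ := (-(a j x₀))⁻¹ • x₀ with hx₁
      have hpos : 0 < (-(a j x₀))⁻¹ := inv_pos.2 (by linarith)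
      have hj₁ : a j x₁ = -1 := by
        rw [hx₁, map_smul, smul_eq_mul]
        rw [inv_neg, neg_mul, inv_mul_cancel₀ hj₀.ne]
      have ha₁ : ∀ i ∈ s, 0 ≤ a i x₁ := fun i hi => by
        rw [hx₁, map_smul, smul_eq_mul]
        exact mul_nonneg hpos.le (hx₀ i hi)
      have hb₁ : b x₁ ≤ 0 := by
        rw [hx₁, map_smul, smul_eq_mul]
        exact mul_nonpos_of_nonneg_of_nonpos hpos.le hbx₀.le
      obtain ⟨lam, hlam, hsum⟩ := ih (fun i => a i + a i x₁ • a j) (b + b x₁ • a j) (by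
        intro x hx
        have := h (x + a j x • x₁) (by
          intro i hi
          rcases mem_insert.1 hi with rfl | hi
          · simp [hj₁]
          · have := hx i hi
            simp only [LinearMap.add_apply, LinearMap.smul_apply, smul_eq_mul] at this
            simp only [map_add, map_smul, smul_eq_mul]
            linarith)
        simp only [map_add, map_smul, smul_eq_mul] at this
        simp only [LinearMap.add_apply, LinearMap.smul_apply, smul_eq_mul]
        linarith)
      have hc : 0 ≤ ∑ i ∈ s, lam i * a i x₁ - b x₁ := by
        have := sum_nonneg fun i hi => mul_nonneg (hlam i) (ha₁ i hi)
        linarith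
      -- The multiplier of `a j` is its total coefficient once the pulled-back identity is solved
      -- for `b`.
      refine ⟨fun i => if i = j then ∑ i ∈ s, lam i * a i x₁ - b x₁ else lam i, fun i => ?_, ?_⟩
      · dsimp only
        split_ifs
        exacts [hc, hlam i]
      · rw [sum_insert hj]
        dsimp only
        rw [if_pos rfl]
        have hcongr : ∑ i ∈ s, (if i = j then ∑ i ∈ s, lam i * a i x₁ - b x₁ else lam i) • a i
            = ∑ i ∈ s, lam i • a i :=
          sum_congr rfl fun i hi => by rw [if_neg (ne_of_mem_of_not_mem hi hj)]
        rw [hcongr]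
        ext x
        have hx := LinearMap.congr_fun hsum x
        simp only [LinearMap.sum_apply, LinearMap.add_apply, LinearMap.smul_apply, smul_eq_mul,
          mul_add, sum_add_distrib, ← mul_assoc, ← sum_mul] at hx ⊢
        linarith

/-- Farkas' lemma for a finite system of inequalities and equations. -/
theorem exists_multipliers [Fintype ι] [Fintype κ] (a : ι → E →ₗ[ℝ] ℝ) (e : κ → E →ₗ[ℝ] ℝ)
    (b : E →ₗ[ℝ] ℝ) (h : ∀ x, (∀ i, 0 ≤ a i x) → (∀ k, e k x = 0) → 0 ≤ b x) :
    ∃ (lam : ι → ℝ) (mu : κ → ℝ), (∀ i, 0 ≤ lam i) ∧ ∑ i, lam i • a i + ∑ k, mu k • e k = b := by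
  obtain ⟨lam, hlam, hsum⟩ := exists_nonneg_sum_smul_eq_of_finset univ
    (Sum.elim a (Sum.elim e (fun k => -e k))) b (by
      intro x hx
      refine h x (fun i => hx (.inl i) (mem_univ _)) fun k => le_antisymm ?_ ?_
      · simpa using hx (.inr (.inr k)) (mem_univ _)
      · simpa using hx (.inr (.inl k)) (mem_univ _))
  refine ⟨fun i => lam (.inl i), fun k => lam (.inr (.inl k)) - lam (.inr (.inr k)),
    fun i => hlam _, ?_⟩
  ext x
  rw [← hsum, Fintype.sum_sum_type, Fintype.sum_sum_type]
  simp only [Sum.elim_inl, Sum.elim_inr, LinearMap.add_apply, LinearMap.sum_apply,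
    LinearMap.smul_apply, LinearMap.neg_apply, smul_eq_mul, sub_mul, sum_sub_distrib, mul_neg,
    sum_neg_distrib]
  ring

end Farkas

/-! ### Strong duality, attainment and complementary slackness -/

namespace LinProg

variable {E ι κ : Type*} [AddCommGroup E] [Module ℝ E]

/-- The functional `(x, t) ↦ f x - c * t`. -/
def homogenize (f : E →ₗ[ℝ] ℝ) (c : ℝ) : E × ℝ →ₗ[ℝ] ℝ :=
  f ∘ₗ LinearMap.fst ℝ E ℝ - c • LinearMap.snd ℝ E ℝ

@[simp] theorem homogenize_apply (f : E →ₗ[ℝ] ℝ) (c : ℝ) (x : E × ℝ) :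
    homogenize f c x = f x.1 - c * x.2 := rfl

/-- A solution `(x, t)` with `t > 0` of the homogenized system gives a feasible point. -/
theorem mem_feasible_of_homogenize (P : LinProg E ι κ) {x : E × ℝ} (ht : 0 < x.2)
    (hi : ∀ i, 0 ≤ homogenize (P.ineq i) (P.ineqRhs i) x)
    (he : ∀ k, homogenize (P.eqn k) (P.eqnRhs k) x = 0) : x.2⁻¹ • x.1 ∈ P.feasible := by
  simp only [homogenize_apply] at hi he
  refine ⟨fun i => ?_, fun k => ?_⟩
  · rw [map_smul, smul_eq_mul, ← div_eq_inv_mul, le_div_iff₀ ht]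
    linarith [hi i]
  · rw [map_smul, smul_eq_mul, ← div_eq_inv_mul, div_eq_iff ht.ne']
    linarith [he k]

variable [Fintype ι] [Fintype κ]

theorem weak_duality (P : LinProg E ι κ) {lam : ι → ℝ} {mu : κ → ℝ} (h : P.DualFeasible lam mu)
    {x : E} (hx : x ∈ P.feasible) : P.dualObj lam mu ≤ P.cost x := by
  rw [← h.2, dualObj]
  simp only [LinearMap.add_apply, LinearMap.sum_apply, LinearMap.smul_apply, smul_eq_mul, hx.2]
  gcongr with i
  exacts [h.1 i, hx.1 i]

/-- Infeasibility means that the homogenized constraints force `t ≤ 0`. Farkas' lemma then writes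
`-t` as a combination of them; comparing the `x` and `t` parts gives the certificate. -/
theorem exists_multipliers_of_feasible_eq_empty (P : LinProg E ι κ) (h : P.feasible = ∅) :
    ∃ (lam : ι → ℝ) (mu : κ → ℝ), (∀ i, 0 ≤ lam i) ∧
      ∑ i, lam i • P.ineq i + ∑ k, mu k • P.eqn k = 0 ∧ 0 < P.dualObj lam mu := by
  obtain ⟨lam, mu, hlam, hsum⟩ := exists_multipliers
    (fun i => homogenize (P.ineq i) (P.ineqRhs i)) (fun k => homogenize (P.eqn k) (P.eqnRhs k))
    (homogenize 0 1) (by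
      intro x hi he
      by_contra hneg
      have ht : 0 < x.2 := by simpa using hneg
      exact (h ▸ P.mem_feasible_of_homogenize ht hi he : x.2⁻¹ • x.1 ∈ (∅ : Set E)))
  refine ⟨lam, mu, hlam, ?_, ?_⟩
  · ext x
    simpa using LinearMap.congr_fun hsum (x, 0)
  · have := LinearMap.congr_fun hsum (0, 1)
    simp only [LinearMap.add_apply, LinearMap.sum_apply, LinearMap.smul_apply, smul_eq_mul,
      homogenize_apply, map_zero, mul_one, zero_sub, mul_neg, sum_neg_distrib] at this
    rw [dualObj]
    linarith

/-- Farkas' lemma is applied to the homogenized constraints together with `t ≥ 0` (index `none`).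
They imply `cost x - z * t ≥ 0`: by scaling if `t > 0`, and by the recession argument `hrec` if `t =
0`. -/
theorem exists_dualFeasible_of_le_cost (P : LinProg E ι κ) (hP : P.feasible.Nonempty) {z : ℝ}
    (hz : ∀ x ∈ P.feasible, z ≤ P.cost x) :
    ∃ lam mu, P.DualFeasible lam mu ∧ z ≤ P.dualObj lam mu := by
  obtain ⟨x₀, hx₀⟩ := hP
  have hrec : ∀ x, (∀ i, 0 ≤ P.ineq i x) → (∀ k, P.eqn k x = 0) → 0 ≤ P.cost x := by
    intro x hi he
    by_contra! hneg
    have hmem : ∀ r : ℝ, 0 ≤ r → x₀ + r • x ∈ P.feasible := fun r hr =>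
      ⟨fun i => by
        rw [map_add, map_smul, smul_eq_mul]
        linarith [hx₀.1 i, mul_nonneg hr (hi i)], fun k => by
        rw [map_add, map_smul, he, smul_zero, add_zero, hx₀.2 k]⟩
    have hle := hz x₀ hx₀
    -- This step length brings the cost down to `z - 1`.
    have hr : 0 ≤ (P.cost x₀ - z + 1) / (-P.cost x) := div_nonneg (by linarith) (by linarith)
    have h := hz _ (hmem _ hr)
    rw [map_add, map_smul, smul_eq_mul, div_mul_eq_mul_div, div_neg,
      mul_div_cancel_right₀ _ hneg.ne] at h
    linarith
  obtain ⟨lam, mu, hlam, hsum⟩ := exists_multipliers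
    (Option.elim · (homogenize 0 (-1)) fun i => homogenize (P.ineq i) (P.ineqRhs i))
    (fun k => homogenize (P.eqn k) (P.eqnRhs k)) (homogenize P.cost z) (by
      intro x hi he
      have ht : 0 ≤ x.2 := by simpa using hi none
      rcases ht.eq_or_lt with ht | ht
      · have := hrec x.1 (fun i => by simpa [← ht] using hi (some i))
          (fun k => by simpa [← ht] using he k)
        simpa [← ht] using this
      · have := hz _ (P.mem_feasible_of_homogenize ht (fun i => hi (some i)) he)
        rw [map_smul, smul_eq_mul, ← div_eq_inv_mul, le_div_iff₀ ht] at this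
        simpa using this)
  rw [Fintype.sum_option] at hsum
  refine ⟨fun i => lam (some i), mu, ⟨fun i => hlam _, ?_⟩, ?_⟩
  · ext x
    simpa using LinearMap.congr_fun hsum (x, 0)
  · have := LinearMap.congr_fun hsum (0, 1)
    simp only [LinearMap.add_apply, LinearMap.sum_apply, LinearMap.smul_apply, smul_eq_mul,
      homogenize_apply, map_zero, mul_one, zero_sub, mul_neg, sum_neg_distrib,
      Option.elim_none, Option.elim_some] at this
    rw [dualObj]
    linarith [hlam none]

/-- No compactness is needed: if the infimum `z` were not attained, adding `cost x ≤ z` would make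
the program infeasible. The certificate then either refutes feasibility of `P` (weight zero on the
new constraint) or yields a lower bound exceeding `z`. -/
theorem exists_isOptimal (P : LinProg E ι κ) (hP : P.feasible.Nonempty) {m : ℝ}
    (hm : ∀ x ∈ P.feasible, m ≤ P.cost x) : ∃ x, P.IsOptimal x := by
  have hbdd : BddBelow (P.cost '' P.feasible) := ⟨m, by rintro _ ⟨x, hx, rfl⟩; exact hm x hx⟩
  set z := sInf (P.cost '' P.feasible) with hz
  have hzle : ∀ x ∈ P.feasible, z ≤ P.cost x := fun x hx => csInf_le hbdd ⟨x, hx, rfl⟩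
  let P' : LinProg E (Option ι) κ :=
    { cost := P.cost, ineq := (Option.elim · (-P.cost) P.ineq),
      ineqRhs := (Option.elim · (-z) P.ineqRhs), eqn := P.eqn, eqnRhs := P.eqnRhs }
  by_cases hne : P'.feasible.Nonempty
  · obtain ⟨x, hi, he⟩ := hne
    refine ⟨x, ⟨fun i => hi (some i), he⟩, fun y hy => le_trans ?_ (hzle y hy)⟩
    simpa [P'] using hi none
  · obtain ⟨lam, mu, hlam, hsum, hpos⟩ :=
      P'.exists_multipliers_of_feasible_eq_empty (Set.not_nonempty_iff_eq_empty.1 hne)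
    exfalso
    have hsum' : ∀ x, ∑ i, lam (some i) * P.ineq i x + ∑ k, mu k * P.eqn k x
        = lam none * P.cost x := by
      intro x
      have := LinearMap.congr_fun hsum x
      rw [Fintype.sum_option] at this
      simp only [P', LinearMap.add_apply, LinearMap.sum_apply, LinearMap.smul_apply, smul_eq_mul,
        LinearMap.neg_apply, LinearMap.zero_apply, Option.elim_none, Option.elim_some] at this
      linarith
    have hobj : lam none * z < P.dualObj (fun i => lam (some i)) mu := by
      rw [dualObj, Fintype.sum_option] at hpos
      simp only [P', Option.elim_none, Option.elim_some] at hpos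
      rw [dualObj]
      linarith
    have hle : ∀ x ∈ P.feasible, P.dualObj (fun i => lam (some i)) mu ≤ lam none * P.cost x := by
      intro x hx
      rw [← hsum', dualObj]
      simp only [hx.2]
      gcongr with i
      exacts [hlam _, hx.1 i]
    rcases (hlam none).eq_or_lt with h0 | h0
    · obtain ⟨x, hx⟩ := hP
      have := hle x hx
      rw [← h0, zero_mul] at hobj this
      linarith
    · have : P.dualObj (fun i => lam (some i)) mu / lam none ≤ z := by
        refine le_csInf (hP.image _) ?_
        rintro _ ⟨x, hx, rfl⟩
        rw [div_le_iff₀ h0, mul_comm]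
        exact hle x hx
      rw [div_le_iff₀ h0, mul_comm] at this
      linarith

theorem isDualOptimal_of_cost_le (P : LinProg E ι κ) {x : E} (hx : x ∈ P.feasible)
    {lam : ι → ℝ} {mu : κ → ℝ} (h : P.DualFeasible lam mu) (hle : P.cost x ≤ P.dualObj lam mu) :
    P.IsDualOptimal lam mu :=
  ⟨h, fun _ _ h' => (P.weak_duality h' hx).trans hle⟩

theorem exists_dualFeasible_eq_cost (P : LinProg E ι κ) {x : E} (hx : P.IsOptimal x) :
    ∃ lam mu, P.DualFeasible lam mu ∧ P.dualObj lam mu = P.cost x := by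
  obtain ⟨lam, mu, h, hle⟩ := P.exists_dualFeasible_of_le_cost ⟨x, hx.1⟩ hx.2
  exact ⟨lam, mu, h, le_antisymm (P.weak_duality h hx.1) hle⟩

theorem IsDualOptimal.dualObj_eq {P : LinProg E ι κ} {lam : ι → ℝ} {mu : κ → ℝ}
    (h : P.IsDualOptimal lam mu) {x : E} (hx : P.IsOptimal x) : P.dualObj lam mu = P.cost x := by
  obtain ⟨lam', mu', h', heq⟩ := P.exists_dualFeasible_eq_cost hx
  exact le_antisymm (P.weak_duality h.1 hx.1) (heq ▸ h.2 _ _ h')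

/-- A feasible program whose cost is nonnegative on its recession cone has an optimal solution. -/
theorem exists_isOptimal_of_recession (P : LinProg E ι κ) (hP : P.feasible.Nonempty)
    (h : ∀ x, (∀ i, 0 ≤ P.ineq i x) → (∀ k, P.eqn k x = 0) → 0 ≤ P.cost x) :
    ∃ x, P.IsOptimal x := by
  obtain ⟨lam, mu, hlam, hsum⟩ := exists_multipliers P.ineq P.eqn P.cost h
  exact P.exists_isOptimal hP fun x hx => P.weak_duality ⟨hlam, hsum⟩ hx

/-- Complementary slackness: a feasible point at which all inequalities are tight that are tight
at an optimal solution is optimal. -/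
theorem IsOptimal.of_tight {P : LinProg E ι κ} {x y : E} (hx : P.IsOptimal x)
    (hy : y ∈ P.feasible) (h : ∀ i, P.ineq i x = P.ineqRhs i → P.ineq i y = P.ineqRhs i) :
    P.IsOptimal y := by
  obtain ⟨lam, mu, hd, hobj⟩ := P.exists_dualFeasible_eq_cost hx
  have hcost : ∀ u ∈ P.feasible, P.cost u - P.dualObj lam mu
      = ∑ i, lam i * (P.ineq i u - P.ineqRhs i) := by
    intro u hu
    rw [← hd.2, dualObj]
    simp only [LinearMap.add_apply, LinearMap.sum_apply, LinearMap.smul_apply, smul_eq_mul, hu.2,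
      mul_sub, sum_sub_distrib]
    ring
  have hzero : ∀ i, lam i * (P.ineq i x - P.ineqRhs i) = 0 := by
    have h0 := hcost x hx.1
    rw [hobj, sub_self, eq_comm, sum_eq_zero_iff_of_nonneg
      (fun i _ => mul_nonneg (hd.1 i) (sub_nonneg.2 (hx.1.1 i)))] at h0
    exact fun i => h0 i (mem_univ i)
  have hyc : P.cost y = P.cost x := by
    have h0 := hcost y hy
    rw [hobj, sum_eq_zero, sub_eq_zero] at h0
    · exact h0
    · intro i _
      rcases mul_eq_zero.1 (hzero i) with h1 | h1
      · rw [h1, zero_mul]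
      · rw [h i (sub_eq_zero.1 h1), sub_self, mul_zero]
  exact ⟨hy, fun u hu => hyc ▸ hx.2 u hu⟩

/-- A mixed-binary program attains its minimum if the cost is bounded below. -/
theorem exists_isOptimal_binary {β : Type*} [Fintype β] (P : LinProg E ι κ)
    (f : β → E →ₗ[ℝ] ℝ) (hne : ∃ x ∈ P.feasible, ∀ i, f i x = 0 ∨ f i x = 1) {m : ℝ}
    (hm : ∀ x ∈ P.feasible, m ≤ P.cost x) :
    ∃ x ∈ P.feasible, (∀ i, f i x = 0 ∨ f i x = 1) ∧
      ∀ y ∈ P.feasible, (∀ i, f i y = 0 ∨ f i y = 1) → P.cost x ≤ P.cost y := by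
  classical
  -- Fixing the binary values leaves one linear program for each of finitely many patterns `σ`; the
  -- best of the feasible ones is taken.
  let Q : (β → Bool) → LinProg E ι (κ ⊕ β) := fun σ =>
    { cost := P.cost, ineq := P.ineq, ineqRhs := P.ineqRhs, eqn := Sum.elim P.eqn f,
      eqnRhs := Sum.elim P.eqnRhs fun i => if σ i then 1 else 0 }
  have hsub : ∀ σ, ∀ x ∈ (Q σ).feasible, x ∈ P.feasible ∧ ∀ i, f i x = 0 ∨ f i x = 1 := by
    intro σ x hx
    refine ⟨⟨hx.1, fun k => hx.2 (.inl k)⟩, fun i => ?_⟩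
    have := hx.2 (.inr i)
    simp only [Q, Sum.elim_inr] at this
    split_ifs at this
    exacts [.inr this, .inl this]
  have hcover : ∀ x ∈ P.feasible, (∀ i, f i x = 0 ∨ f i x = 1) → ∃ σ, x ∈ (Q σ).feasible := by
    intro x hx hbin
    refine ⟨fun i => decide (f i x = 1), hx.1, ?_⟩
    rintro (k | i)
    · exact hx.2 k
    · rcases hbin i with h | h <;> simp [Q, h]
  have hopt : ∀ σ : {σ // (Q σ).feasible.Nonempty}, ∃ x, (Q σ).IsOptimal x := fun σ =>
    (Q σ).exists_isOptimal σ.2 fun x hx => hm x (hsub _ x hx).1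
  choose x hx using hopt
  obtain ⟨x₀, hx₀, hbin₀⟩ := hne
  obtain ⟨σ₀, hσ₀⟩ := hcover x₀ hx₀ hbin₀
  obtain ⟨σ, -, hσ⟩ := exists_min_image univ (fun σ => P.cost (x σ)) ⟨⟨σ₀, x₀, hσ₀⟩, mem_univ _⟩
  refine ⟨x σ, (hsub _ _ (hx σ).1).1, (hsub _ _ (hx σ).1).2, fun y hy hbin => ?_⟩
  obtain ⟨τ, hτ⟩ := hcover y hy hbin
  exact (hσ ⟨τ, y, hτ⟩ (mem_univ _)).trans ((hx ⟨τ, y, hτ⟩).2 y hτ)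

end LinProg

/-! ## Unit flows in acyclic networks -/

/-- In an acyclic network, whose nodes and arcs are ranked along the paths, a node has a binary
unit flow to the sink that uses only arcs with positive `x`, provided that each active node is left
by such an arc, which leads to the sink or to an active node. -/
theorem exists_binary_unit_flow {V C : Type*} [DecidableEq V] [DecidableEq C]
    (balance : C → (V → ℝ) →ₗ[ℝ] ℝ) (x : V → ℝ) (rank : V → ℕ) (level : C → ℕ) (M : ℕ)
    (hM : ∀ c, level c ≤ M) (active : C → Prop)
    (hstep : ∀ c, active c → ∃ v, 0 < x v ∧ rank v = level c ∧
      ((∀ c', balance c' (Pi.single v 1) = (Pi.single c 1 : C → ℝ) c') ∨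
        ∃ c₂, active c₂ ∧ level c < level c₂ ∧
          ∀ c', balance c' (Pi.single v 1) = (Pi.single c 1 - Pi.single c₂ 1 : C → ℝ) c')) :
    ∀ c, active c → ∃ u : V → ℝ, (∀ v, u v = 0 ∨ u v = 1) ∧ (∀ v, u v ≠ 0 → 0 < x v) ∧
      (∀ v, rank v < level c → u v = 0) ∧ ∀ c', balance c' u = (Pi.single c 1 : C → ℝ) c' := by
  suffices h : ∀ n c, M - level c < n → active c → ∃ u : V → ℝ, (∀ v, u v = 0 ∨ u v = 1) ∧
      (∀ v, u v ≠ 0 → 0 < x v) ∧ (∀ v, rank v < level c → u v = 0) ∧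
      ∀ c', balance c' u = (Pi.single c 1 : C → ℝ) c' from fun c hc => h _ c (Nat.lt_succ_self _) hc
  intro n
  induction n with
  | zero => intro c h; omega
  | succ n ih =>
    intro c hn hc
    obtain ⟨v, hxv, hv, hsink | ⟨c₂, hc₂, hlt, hbal⟩⟩ := hstep c hc
    · refine ⟨Pi.single v 1, fun v' => ?_, fun v' h => ?_, fun v' h => ?_, hsink⟩
      · by_cases h : v' = v
        · exact .inr (by rw [h, Pi.single_eq_same])
        · exact .inl (Pi.single_eq_of_ne h _)
      · by_cases h' : v' = v
        · rwa [h']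
        · exact absurd (Pi.single_eq_of_ne h' _) h
      · exact Pi.single_eq_of_ne (by rintro rfl; omega) _
    · obtain ⟨u, hbin, hsupp, hrank, hu⟩ := ih c₂ (by have := hM c₂; omega) hc₂
      -- The flow from the later node `c₂` cannot use `v`, so adding `v` keeps it binary.
      have huv : u v = 0 := hrank v (by omega)
      have hval : ∀ v', v' ≠ v → (Pi.single v 1 + u : V → ℝ) v' = u v' := fun v' h => by
        rw [Pi.add_apply, Pi.single_eq_of_ne h, zero_add]
      refine ⟨Pi.single v 1 + u, fun v' => ?_, fun v' h => ?_, fun v' h => ?_, fun c' => ?_⟩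
      · by_cases h : v' = v
        · exact .inr (by rw [h, Pi.add_apply, Pi.single_eq_same, huv, add_zero])
        · rw [hval v' h]; exact hbin v'
      · by_cases h' : v' = v
        · rwa [h']
        · rw [hval v' h'] at h; exact hsupp v' h
      · rw [hval v' (by rintro rfl; omega)]
        exact hrank v' (by omega)
      · rw [map_add, hbal, hu, Pi.sub_apply, sub_add_cancel]

namespace Generator

variable (G : Generator) {T : ℕ}

/-! ## The constraints of the extended formulation -/

theorem mem_laterOn {t k : ℕ} : (t, k) ∈ G.laterOn T ↔
    G.t₀ + G.ℓ + 1 ≤ t ∧ t ≤ T ∧ k ≤ T ∧ min (t + G.L - 1) T ≤ k := by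
  simp only [laterOn, mem_filter, mem_product, mem_Icc, mem_range]
  omega

theorem mem_offIntervals {k t : ℕ} : (k, t) ∈ G.offIntervals T ↔
    G.t₀ ≤ k ∧ t ≤ T ∧ k + G.ℓ + 1 ≤ t := by
  simp only [offIntervals, mem_filter, mem_product, mem_Icc, mem_range]
  omega

theorem mem_firstOn {t k : ℕ} : (t, k) ∈ G.firstOn T ↔ t = 1 ∧ max G.t₀ 1 ≤ k ∧ k ≤ T := by
  simp only [firstOn, mem_product, mem_singleton, mem_Icc]

variable (T) in
/-- The variable that indicates whether `[t, k]` is an on-interval. -/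
def statusVar (p : ℕ × ℕ) : Var := if p ∈ G.firstOn T then .w p.2 else .y p.1 p.2

theorem status_eq_coord (p : ℕ × ℕ) : G.status T p = coord (G.statusVar T p) := by
  rw [status, statusVar]
  split_ifs <;> rfl

@[simp] theorem status_apply (p : ℕ × ℕ) (x : Plan) : G.status T p x = x (G.statusVar T p) := by
  rw [status_eq_coord, LinearMap.proj_apply]

theorem eqn_total_apply (x : Plan) :
    G.eqn T .total x = ∑ t ∈ Icc G.t₀ T, x (.w t) := by
  simp [eqn]

theorem eqn_shutDown_apply (x : Plan) (t : Ico G.t₀ T) :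
    G.eqn T (.shutDown t) x = -x (.w t) + ∑ k ∈ Icc (t + G.ℓ + 1) T, x (.z t k)
      - ∑ k ∈ Icc (G.t₀ + G.ℓ + 1) (t + 1 - G.L), x (.y k t) + x (.θ t) := by
  simp [eqn]

theorem eqn_startUp_apply (x : Plan) (t : Icc (G.t₀ + G.ℓ + 1) T) :
    G.eqn T (.startUp t) x = ∑ k ∈ Icc (min (t + G.L - 1) T) T, x (.y t k)
      - ∑ k ∈ Icc G.t₀ (t - G.ℓ - 1), x (.z k t) := by
  simp [eqn]

/-- The predecessors of a shut-down in period `k + 1`. -/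
theorem mem_laterOn_of_mem_Icc {t k : ℕ} (hk : k < T)
    (h : t ∈ Icc (G.t₀ + G.ℓ + 1) (k + 1 - G.L)) : (t, k) ∈ G.laterOn T := by
  have := G.L_pos
  rw [mem_Icc] at h
  rw [mem_laterOn]
  omega

/-- The successors of a start-up in period `t`. -/
theorem mem_laterOn_of_mem_Icc_min {t k : ℕ} (h₁ : G.t₀ + G.ℓ + 1 ≤ t) (h₂ : t ≤ T)
    (h : k ∈ Icc (min (t + G.L - 1) T) T) : (t, k) ∈ G.laterOn T := by
  rw [mem_Icc] at h
  rw [mem_laterOn]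
  omega

/-- The predecessors of a start-up in period `t`. -/
theorem mem_offIntervals_of_mem_Icc {k t : ℕ} (h₁ : G.t₀ + G.ℓ + 1 ≤ t) (h₂ : t ≤ T)
    (h : k ∈ Icc G.t₀ (t - G.ℓ - 1)) : (k, t) ∈ G.offIntervals T := by
  rw [mem_Icc] at h
  rw [mem_offIntervals]
  omega

/-- The successors of a shut-down in period `k + 1`. -/
theorem mem_offIntervals_of_mem_Icc_add {k t : ℕ} (h₁ : G.t₀ ≤ k)
    (h : t ∈ Icc (k + G.ℓ + 1) T) : (k, t) ∈ G.offIntervals T := by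
  rw [mem_Icc] at h
  rw [mem_offIntervals]
  omega

section Cone

variable {G} {x : Plan} (hx : ∀ c, 0 ≤ G.ineq T c x)

include hx

theorem w_nonneg {t : ℕ} (h₁ : G.t₀ ≤ t) (h₂ : t ≤ T) : 0 ≤ x (.w t) :=
  hx (.wNonneg ⟨t, mem_Icc.2 ⟨h₁, h₂⟩⟩)

theorem y_nonneg {t k : ℕ} (h : (t, k) ∈ G.laterOn T) : 0 ≤ x (.y t k) := hx (.yNonneg ⟨_, h⟩)

theorem z_nonneg {k t : ℕ} (h : (k, t) ∈ G.offIntervals T) : 0 ≤ x (.z k t) :=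
  hx (.zNonneg ⟨_, h⟩)

theorem θ_nonneg {t : ℕ} (h₁ : G.t₀ ≤ t) (h₂ : t < T - G.ℓ) : 0 ≤ x (.θ t) :=
  hx (.θNonneg ⟨t, mem_Ico.2 ⟨h₁, h₂⟩⟩)

/-! ## The recession cone -/

variable (he : ∀ c, G.eqn T c x = 0)

include he

theorem w_eq_zero {t : ℕ} (h₁ : G.t₀ ≤ t) (h₂ : t ≤ T) : x (.w t) = 0 := by
  have h := he .total
  rw [eqn_total_apply, sum_eq_zero_iff_of_nonneg fun t ht =>
    w_nonneg hx (mem_Icc.1 ht).1 (mem_Icc.1 ht).2] at h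
  exact h t (mem_Icc.2 ⟨h₁, h₂⟩)

/-- Conservation at the shut-down node: with zero inflow, the nonnegative outflows vanish. -/
theorem z_eq_zero_of_y_eq_zero {k t : ℕ} (h : (k, t) ∈ G.offIntervals T)
    (hy : ∀ t' ≤ k, (t', k) ∈ G.laterOn T → x (.y t' k) = 0) : x (.z k t) = 0 := by
  have hkt := G.mem_offIntervals.1 h
  have hL := G.L_pos
  have hk := he (.shutDown ⟨k, mem_Ico.2 (by omega)⟩)
  have hy0 : ∑ t' ∈ Icc (G.t₀ + G.ℓ + 1) (k + 1 - G.L), x (.y t' k) = 0 :=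
    sum_eq_zero fun t' ht' => hy t' (by rw [mem_Icc] at ht'; omega)
      (G.mem_laterOn_of_mem_Icc (by omega) ht')
  have hz0 : ∀ t' ∈ Icc (k + G.ℓ + 1) T, 0 ≤ x (.z k t') := fun t' ht' =>
    z_nonneg hx (G.mem_offIntervals_of_mem_Icc_add hkt.1 ht')
  rw [eqn_shutDown_apply, w_eq_zero hx he (by exact hkt.1) (by dsimp only; omega), hy0] at hk
  -- `k + ℓ + 1 ≤ t ≤ T` puts `k` in the range where `θ` is sign-constrained.
  have hθ := θ_nonneg hx hkt.1 (by omega)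
  refine le_antisymm ?_ (z_nonneg hx h)
  have := single_le_sum hz0 (mem_Icc.2 ⟨hkt.2.2, hkt.2.1⟩)
  dsimp only at hk this
  linarith

/-- An acyclic network carries no nonzero nonnegative circulation: a start-up at `t` is fed only
through on-intervals that started earlier. -/
theorem y_eq_zero {t : ℕ} : ∀ {k : ℕ}, (t, k) ∈ G.laterOn T → x (.y t k) = 0 := by
  induction t using Nat.strong_induction_on with
  | _ t ih =>
    intro k h
    have htk := G.mem_laterOn.1 h
    have ht := he (.startUp ⟨t, mem_Icc.2 ⟨htk.1, htk.2.1⟩⟩)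
    have hz0 : ∑ k' ∈ Icc G.t₀ (t - G.ℓ - 1), x (.z k' t) = 0 := sum_eq_zero fun k' hk' => by
      refine z_eq_zero_of_y_eq_zero hx he (G.mem_offIntervals_of_mem_Icc htk.1 htk.2.1 hk')
        fun t' ht' => ih t' ?_
      rw [mem_Icc] at hk'
      omega
    rw [eqn_startUp_apply, hz0, sub_zero, sum_eq_zero_iff_of_nonneg fun k' hk' =>
      y_nonneg hx (G.mem_laterOn_of_mem_Icc_min htk.1 htk.2.1 hk')] at ht
    exact ht k (mem_Icc.2 ⟨htk.2.2.2, htk.2.2.1⟩)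

theorem z_eq_zero {k t : ℕ} (h : (k, t) ∈ G.offIntervals T) : x (.z k t) = 0 :=
  z_eq_zero_of_y_eq_zero hx he h fun _ _ h' => y_eq_zero hx he h'

theorem statusVar_eq_zero {p : ℕ × ℕ} (hp : p ∈ G.onIntervals T) : x (G.statusVar T p) = 0 := by
  obtain ⟨t, k⟩ := p
  rw [statusVar]
  split_ifs with h
  · have := G.mem_firstOn.1 h
    exact w_eq_zero hx he (by dsimp only; omega) (by dsimp only; omega)
  · exact y_eq_zero hx he ((mem_union.1 hp).resolve_left h)

theorem q_eq_zero {p : ℕ × ℕ} (hp : p ∈ G.onIntervals T) {s : ℕ} (hs : s ∈ Icc p.1 p.2) :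
    x (.q p.1 p.2 s) = 0 := by
  have h₁ := hx (.genLower ⟨p, hp⟩ ⟨s, hs⟩)
  have h₂ := hx (.genUpper ⟨p, hp⟩ ⟨s, hs⟩)
  simp only [ineq, LinearMap.sub_apply, LinearMap.smul_apply, status_apply, LinearMap.proj_apply,
    statusVar_eq_zero hx he hp, smul_zero, sub_zero, zero_sub] at h₁ h₂
  linarith

theorem φ_nonneg {p : ℕ × ℕ} (hp : p ∈ G.onIntervals T) {s : ℕ} (hs : s ∈ Icc p.1 p.2) :
    0 ≤ x (.φ p.1 p.2 s) := by
  have h := hx (.genCost ⟨p, hp⟩ ⟨s, hs⟩ ⟨0, G.N_pos⟩)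
  simpa only [ineq, LinearMap.sub_apply, LinearMap.smul_apply, status_apply, LinearMap.proj_apply,
    statusVar_eq_zero hx he hp, q_eq_zero hx he hp hs, smul_zero, sub_zero] using h

theorem output_eq_zero (s : ℕ) : G.output T s x = 0 := by
  rw [output, LinearMap.sum_apply]
  refine sum_eq_zero fun p hp => ?_
  rw [mem_filter] at hp
  exact q_eq_zero hx he hp.1 (mem_Icc.2 hp.2)

/-- Only generation costs survive in a recession direction. As outputs vanish there too, profits are
bounded above for prices of any sign. -/
theorem cost_nonneg : 0 ≤ G.cost T x := by
  have hL := G.L_pos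
  simp only [cost, LinearMap.add_apply, LinearMap.sum_apply, LinearMap.smul_apply,
    LinearMap.proj_apply]
  rw [sum_eq_zero, sum_eq_zero, sum_eq_zero, add_zero, add_zero, zero_add]
  · exact sum_nonneg fun p hp => sum_nonneg fun s hs => φ_nonneg hx he hp hs
  · intro p hp
    rw [z_eq_zero hx he hp, smul_zero]
  · intro t ht
    refine sum_eq_zero fun k hk => ?_
    rw [mem_Icc] at ht
    rw [mem_Ico] at hk
    rw [y_eq_zero hx he (by rw [mem_laterOn]; omega), smul_zero]
  · intro t ht
    rw [mem_Ico] at ht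
    rw [w_eq_zero hx he ht.1 ht.2.le, smul_zero]

end Cone

/-! ## Unit flows in the network of a generator -/

instance : DecidableEq Var := Classical.decEq Var

instance : DecidableEq (G.Eqn T) := Classical.decEq _

/-- This and the next lemmas identify the columns of the equations with those of an incidence
matrix: `+1` at the tail of an arc, `-1` at its head. The arcs `w T`, `y t T` and `θ t` end in the
sink. -/
theorem balance_w {t : ℕ} (h₁ : G.t₀ ≤ t) (h₂ : t < T) (c : G.Eqn T) :
    G.eqn T c (Pi.single (.w t) 1) =
      (Pi.single .total 1 - Pi.single (.shutDown ⟨t, mem_Ico.2 ⟨h₁, h₂⟩⟩) 1 : _ → ℝ) c := by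
  rcases c with _ | ⟨t', ht'⟩ | ⟨t', ht'⟩
  · rw [eqn_total_apply]
    simp [Pi.single_apply, h₁, h₂.le]
  · rw [eqn_shutDown_apply]
    simp [Pi.single_apply]
  · rw [eqn_startUp_apply]
    simp

theorem balance_w_last (h : G.t₀ ≤ T) (c : G.Eqn T) :
    G.eqn T c (Pi.single (.w T) 1) = (Pi.single .total 1 : _ → ℝ) c := by
  rcases c with _ | ⟨t', ht'⟩ | ⟨t', ht'⟩
  · rw [eqn_total_apply]
    simp [Pi.single_apply, h]
  · rw [mem_Ico] at ht'
    rw [eqn_shutDown_apply]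
    simp [ht'.2.ne]
  · rw [eqn_startUp_apply]
    simp

theorem balance_y {t k : ℕ} (h : (t, k) ∈ G.laterOn T) (hk : k < T) (ht : t ∈ Icc _ T)
    (hk' : k ∈ Ico _ T) (c : G.Eqn T) :
    G.eqn T c (Pi.single (.y t k) 1) =
      (Pi.single (.startUp ⟨t, ht⟩) 1 - Pi.single (.shutDown ⟨k, hk'⟩) 1 : _ → ℝ) c := by
  rw [mem_laterOn] at h
  have hL := G.L_pos
  rcases c with _ | ⟨t', ht'⟩ | ⟨t', ht'⟩
  · rw [eqn_total_apply]
    simp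
  · rw [eqn_shutDown_apply]
    by_cases htk : t' = k
    · subst htk
      -- As the interval ends before `T`, the truncation of the minimum up time at `T` is inactive.
      have : G.t₀ + G.ℓ + 1 ≤ t ∧ t ≤ t' + 1 - G.L := by omega
      simp [Pi.single_apply, this]
    · simp [htk]
  · rw [eqn_startUp_apply]
    by_cases htk : t' = t
    · subst htk
      have : min (t' + G.L - 1) T ≤ k ∧ k ≤ T := by omega
      simp [Pi.single_apply, this]
    · simp [htk]

theorem balance_y_last {t : ℕ} (ht : t ∈ Icc _ T) (c : G.Eqn T) :
    G.eqn T c (Pi.single (.y t T) 1) = (Pi.single (.startUp ⟨t, ht⟩) 1 : _ → ℝ) c := by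
  rcases c with _ | ⟨t', ht'⟩ | ⟨t', ht'⟩
  · rw [eqn_total_apply]
    simp
  · rw [mem_Ico] at ht'
    rw [eqn_shutDown_apply]
    simp [ht'.2.ne]
  · rw [eqn_startUp_apply]
    by_cases htk : t' = t
    · subst htk
      simp [Pi.single_apply]
    · simp [htk]

theorem balance_z {k t : ℕ} (h : (k, t) ∈ G.offIntervals T) (hk : k ∈ Ico _ T)
    (ht : t ∈ Icc _ T) (c : G.Eqn T) :
    G.eqn T c (Pi.single (.z k t) 1) =
      (Pi.single (.shutDown ⟨k, hk⟩) 1 - Pi.single (.startUp ⟨t, ht⟩) 1 : _ → ℝ) c := by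
  rw [mem_offIntervals] at h
  rcases c with _ | ⟨t', ht'⟩ | ⟨t', ht'⟩
  · rw [eqn_total_apply]
    simp
  · rw [eqn_shutDown_apply]
    by_cases htk : t' = k
    · subst htk
      simp [Pi.single_apply, h]
    · simp [htk]
  · rw [eqn_startUp_apply]
    by_cases htk : t' = t
    · subst htk
      have : G.t₀ ≤ k ∧ k ≤ t' - G.ℓ - 1 := by omega
      simp [Pi.single_apply, this]
    · simp [htk]

theorem balance_θ {t : ℕ} (ht : t ∈ Ico _ T) (c : G.Eqn T) :
    G.eqn T c (Pi.single (.θ t) 1) = (Pi.single (.shutDown ⟨t, ht⟩) 1 : _ → ℝ) c := by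
  rcases c with _ | ⟨t', ht'⟩ | ⟨t', ht'⟩
  · rw [eqn_total_apply]
    simp
  · rw [eqn_shutDown_apply]
    simp [Pi.single_apply]
  · rw [eqn_startUp_apply]
    simp

/-- The rank of a variable as an arc: the level of the node at which it starts. -/
def rank : Var → ℕ
  | .w _ => 0
  | .y t _ => 2 * t + 1
  | .z k _ => 2 * k + 2
  | .θ t => 2 * t + 2
  | .q _ _ _ => 0
  | .φ _ _ _ => 0

/-- The level of an equation as a node: its position in the order of time. -/
def level : G.Eqn T → ℕ
  | .total => 0
  | .startUp t => 2 * t + 1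
  | .shutDown t => 2 * t + 2

/-- The flow through a node is positive. -/
def Active (x : Plan) : G.Eqn T → Prop
  | .total => True
  | .startUp t => ∃ k ∈ Icc G.t₀ (t - G.ℓ - 1), 0 < x (.z k t)
  | .shutDown t => 0 < x (.w t) ∨ ∃ k ∈ Icc (G.t₀ + G.ℓ + 1) (t + 1 - G.L), 0 < x (.y k t)

variable {G}

/-- A positive flow contains a binary unit flow. -/
theorem exists_binary_flow {x : Plan} (hx : x ∈ G.region T) :
    ∃ u : Plan, (∀ v, u v = 0 ∨ u v = 1) ∧ (∀ v, u v ≠ 0 → 0 < x v) ∧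
      ∀ c, G.eqn T c u = G.eqnRhs T c := by
  have hL := G.L_pos
  obtain ⟨hi, he⟩ := hx
  obtain ⟨u, hbin, hsupp, -, hu⟩ := exists_binary_unit_flow (G.eqn T) x rank G.level (2 * T + 2)
    (by
      rintro (_ | ⟨t, ht⟩ | ⟨t, ht⟩)
      · exact Nat.zero_le _
      · rw [mem_Ico] at ht
        dsimp only [level]
        omega
      · rw [mem_Icc] at ht
        dsimp only [level]
        omega)
    (G.Active x) (by
      rintro (_ | ⟨k, hk⟩ | ⟨t, ht⟩) hc
      · obtain ⟨t, ht, hpos⟩ : ∃ t ∈ Icc G.t₀ T, 0 < x (.w t) := by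
          by_contra! hcon
          have h := he .total
          rw [eqn_total_apply] at h
          have := sum_nonpos hcon
          rw [h] at this
          exact absurd this (by simp [eqnRhs])
        rw [mem_Icc] at ht
        refine ⟨.w t, hpos, rfl, ?_⟩
        rcases ht.2.eq_or_lt with rfl | hlt
        · exact .inl (G.balance_w_last ht.1)
        · exact .inr ⟨.shutDown ⟨t, mem_Ico.2 ⟨ht.1, hlt⟩⟩, .inl hpos, Nat.succ_pos _,
            G.balance_w ht.1 hlt⟩
      · have hk' := mem_Ico.1 hk
        have hw := w_nonneg hi hk'.1 hk'.2.le
        have hy : ∀ t ∈ Icc (G.t₀ + G.ℓ + 1) (k + 1 - G.L), 0 ≤ x (.y t k) := fun t ht =>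
          y_nonneg hi (G.mem_laterOn_of_mem_Icc hk'.2 ht)
        have h := he (.shutDown ⟨k, hk⟩)
        rw [eqn_shutDown_apply] at h
        simp only [eqnRhs] at h
        have hin : 0 < x (.w k) + ∑ t ∈ Icc (G.t₀ + G.ℓ + 1) (k + 1 - G.L), x (.y t k) := by
          rcases hc with hc | ⟨t, ht, hc⟩
          · exact add_pos_of_pos_of_nonneg hc (sum_nonneg hy)
          · exact add_pos_of_nonneg_of_pos hw (hc.trans_le (single_le_sum hy ht))
        -- For `k ≥ T - ℓ`, `θ k` has no sign constraint, but there the sum of the `z` is empty, so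
        -- a positive inflow forces `θ k > 0`.
        by_cases hθ : 0 < x (.θ k)
        · exact ⟨.θ k, hθ, rfl, .inl (G.balance_θ hk)⟩
        · obtain ⟨t, ht, hpos⟩ : ∃ t ∈ Icc (k + G.ℓ + 1) T, 0 < x (.z k t) := by
            by_contra! hcon
            have := sum_nonpos hcon
            linarith
          have hkt := G.mem_offIntervals_of_mem_Icc_add hk'.1 ht
          rw [mem_Icc] at ht
          refine ⟨.z k t, hpos, rfl, .inr ⟨.startUp ⟨t, mem_Icc.2 (by omega)⟩,
            ⟨k, mem_Icc.2 (by dsimp only; omega), hpos⟩, ?_, G.balance_z hkt hk _⟩⟩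
          dsimp only [level]
          omega
      · have ht' := mem_Icc.1 ht
        obtain ⟨k₀, hk₀, hc⟩ := hc
        have hz : ∀ k ∈ Icc G.t₀ (t - G.ℓ - 1), 0 ≤ x (.z k t) := fun k hk =>
          z_nonneg hi (G.mem_offIntervals_of_mem_Icc ht'.1 ht'.2 hk)
        have hin := hc.trans_le (single_le_sum hz hk₀)
        have h := he (.startUp ⟨t, ht⟩)
        rw [eqn_startUp_apply] at h
        simp only [eqnRhs] at h
        obtain ⟨k, hk, hpos⟩ : ∃ k ∈ Icc (min (t + G.L - 1) T) T, 0 < x (.y t k) := by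
          by_contra! hcon
          have := sum_nonpos hcon
          linarith
        have htk := G.mem_laterOn_of_mem_Icc_min ht'.1 ht'.2 hk
        rw [mem_Icc] at hk
        refine ⟨.y t k, hpos, rfl, ?_⟩
        rcases hk.2.eq_or_lt with rfl | hlt
        · exact .inl (G.balance_y_last ht)
        · refine .inr ⟨.shutDown ⟨k, mem_Ico.2 (by omega)⟩,
            .inr ⟨t, mem_Icc.2 (by dsimp only; omega), hpos⟩, ?_, G.balance_y htk hlt ht _⟩
          dsimp only [level]
          omega)
    .total trivial
  refine ⟨u, hbin, hsupp, fun c => ?_⟩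
  rw [hu]
  cases c <;> simp [eqnRhs]

end Generator

namespace Generator

variable (G : Generator) (T : ℕ) (π : Period T → ℝ)

/-! ## Integrality of the extended formulation -/

/-- The relaxed problem of a generator under the prices `π`, in minimization form. -/
def profitLP : LinProg Plan (G.Ineq T) (G.Eqn T) where
  cost := G.cost T - ∑ s, π s • G.output T s
  ineq := G.ineq T
  ineqRhs := fun _ => 0
  eqn := G.eqn T
  eqnRhs := G.eqnRhs T

theorem profitLP_cost_apply (x : Plan) : (G.profitLP T π).cost x = -G.profit T π x := by
  simp [profitLP, profit]

variable {G T}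

theorem exists_isOptimal_profitLP (hG : (G.region T).Nonempty) :
    ∃ x, (G.profitLP T π).IsOptimal x := by
  refine (G.profitLP T π).exists_isOptimal_of_recession hG fun x hi he => ?_
  rw [profitLP_cost_apply, profit, sum_eq_zero fun s _ => by rw [output_eq_zero hi he, mul_zero],
    zero_sub, neg_neg]
  exact cost_nonneg hi he

variable (G T) in
/-- The commitment variable by which a variable is scaled along the rays of the formulation. -/
def commitmentVar : Var → Var
  | .q t k _ => G.statusVar T (t, k)
  | .φ t k _ => G.statusVar T (t, k)
  | v => v

theorem commitmentVar_statusVar (p : ℕ × ℕ) :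
    G.commitmentVar T (G.statusVar T p) = G.statusVar T p := by
  rw [statusVar]
  split_ifs <;> rfl

/-- If the variables of a plan are rescaled such that the generation variables of each on-interval
are scaled like its indicator, then each inequality is rescaled. -/
theorem exists_ineq_rescale (x : Plan) (r : Var → ℝ) (c : G.Ineq T) :
    ∃ v, G.ineq T c (fun v => r (G.commitmentVar T v) * x v) = r v * G.ineq T c x := by
  cases c
  case wNonneg | yNonneg | zNonneg | θNonneg => exact ⟨_, rfl⟩
  case' genLower p _ | genUpper p _ | startRamp p | stopRamp p | rampDown p _ | rampUp p _ |
      genCost p _ _ => refine ⟨G.statusVar T p.1, ?_⟩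
  all_goals
    simp only [ineq, LinearMap.sub_apply, LinearMap.smul_apply, LinearMap.proj_apply,
      status_apply, commitmentVar_statusVar, smul_eq_mul]
    simp only [commitmentVar, Prod.mk.eta]
    ring

/-- The equations involve no generation variables. -/
theorem eqn_congr {x y : Plan} (h : ∀ v, G.commitmentVar T v = v → x v = y v) (c : G.Eqn T) :
    G.eqn T c x = G.eqn T c y := by
  have hw : ∀ t, x (.w t) = y (.w t) := fun t => h _ rfl
  have hy : ∀ t k, x (.y t k) = y (.y t k) := fun t k => h _ rfl
  have hz : ∀ k t, x (.z k t) = y (.z k t) := fun k t => h _ rfl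
  have hθ : ∀ t, x (.θ t) = y (.θ t) := fun t => h _ rfl
  cases c
  · simp only [eqn_total_apply, hw]
  · simp only [eqn_shutDown_apply, hw, hy, hz, hθ]
  · simp only [eqn_startUp_apply, hy, hz]

/-- The relaxed problem of a generator has a binary optimal solution. -/
theorem exists_isOptimal_isBinary (hG : (G.region T).Nonempty) :
    ∃ x, (G.profitLP T π).IsOptimal x ∧ G.IsBinary T x := by
  obtain ⟨x, hx⟩ := exists_isOptimal_profitLP π hG
  obtain ⟨u, hbin, hsupp, hu⟩ := exists_binary_flow (show x ∈ G.region T from hx.1)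
  -- Where `x v ≤ 0`, `hsupp` forces `u v = 0`; so `r v = 0`, also for a zero denominator.
  set r : Var → ℝ := fun v => u v / x v with hr
  have hr0 : ∀ v, 0 ≤ r v := fun v => by
    by_cases h : u v = 0
    · simp [hr, h]
    · refine div_nonneg ?_ (hsupp v h).le
      rcases hbin v with h' | h' <;> simp [h']
  set y : Plan := fun v => r (G.commitmentVar T v) * x v with hy
  have hyu : ∀ v, G.commitmentVar T v = v → y v = u v := fun v hv => by
    rw [hy]
    dsimp only
    rw [hv, hr]
    by_cases h : u v = 0
    · simp [h]
    · exact div_mul_cancel₀ _ (hsupp v h).ne'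
  have hineq : ∀ c, ∃ a, 0 ≤ a ∧ G.ineq T c y = a * G.ineq T c x := fun c => by
    obtain ⟨v, h⟩ := exists_ineq_rescale x r c
    exact ⟨r v, hr0 v, h⟩
  refine ⟨y, hx.of_tight ⟨fun c => ?_, fun c => ?_⟩ fun c hc => ?_, ?_⟩
  · obtain ⟨a, ha, h⟩ := hineq c
    exact h ▸ mul_nonneg ha (hx.1.1 c)
  · exact (eqn_congr hyu c).trans (hu c)
  · obtain ⟨a, -, h⟩ := hineq c
    exact h.trans (by rw [show G.ineq T c x = 0 from hc, mul_zero]; rfl)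
  · refine ⟨fun t _ => ?_, fun p _ => ?_, fun p _ => ?_⟩
    · exact hyu (.w t) rfl ▸ hbin _
    · exact hyu (.y p.1 p.2) rfl ▸ hbin _
    · exact hyu (.z p.1 p.2) rfl ▸ hbin _

theorem isGreatest_maxProfit (hG : (G.region T).Nonempty) :
    IsGreatest (G.profits T π) (G.maxProfit T π) := by
  obtain ⟨x, hx, hbin⟩ := exists_isOptimal_isBinary π hG
  have h : IsGreatest (G.profits T π) (G.profit T π x) := by
    refine ⟨⟨x, ⟨hx.1, hbin⟩, rfl⟩, ?_⟩
    rintro _ ⟨y, hy, rfl⟩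
    have := hx.2 y hy.1
    rw [profitLP_cost_apply, profitLP_cost_apply] at this
    linarith
  rwa [maxProfit, h.csSup_eq]

/-- The maximum profit is the optimal value of the relaxed problem. -/
theorem cost_eq_neg_maxProfit {x : Plan} (hx : (G.profitLP T π).IsOptimal x) :
    (G.profitLP T π).cost x = -G.maxProfit T π := by
  have hG : (G.region T).Nonempty := ⟨x, hx.1⟩
  obtain ⟨y, hy, hbin⟩ := exists_isOptimal_isBinary π hG
  have hmax := isGreatest_maxProfit π hG
  obtain ⟨z, hz, hzp⟩ := hmax.1
  have h₁ := hmax.2 ⟨y, ⟨hy.1, hbin⟩, rfl⟩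
  have h₂ := hx.2 z hz.1
  have h₃ := hy.2 x hx.1
  rw [profitLP_cost_apply, profitLP_cost_apply] at *
  linarith

/-- Fractional plans are included: by integrality they cannot beat the best binary plan. -/
theorem profit_le_maxProfit {x : Plan} (hx : x ∈ G.region T) :
    G.profit T π x ≤ G.maxProfit T π := by
  obtain ⟨y, hy⟩ := exists_isOptimal_profitLP π ⟨x, hx⟩
  have h₁ := cost_eq_neg_maxProfit π hy
  have h₂ := hy.2 x hx
  rw [h₁, profitLP_cost_apply] at h₂
  linarith

variable (G T) in
/-- The binary variables. -/
def binaryVar : Icc G.t₀ T ⊕ G.laterOn T ⊕ G.offIntervals T → Var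
  | .inl t => .w t
  | .inr (.inl p) => .y p.1.1 p.1.2
  | .inr (.inr p) => .z p.1.1 p.1.2

theorem isBinary_iff (x : Plan) :
    G.IsBinary T x ↔ ∀ i, x (G.binaryVar T i) = 0 ∨ x (G.binaryVar T i) = 1 := by
  constructor
  · rintro h (t | p | p)
    · exact h.1 t t.2
    · exact h.2.1 p p.2
    · exact h.2.2 p p.2
  · exact fun h => ⟨fun t ht => h (.inl ⟨t, ht⟩), fun p hp => h (.inr (.inl ⟨p, hp⟩)),
      fun p hp => h (.inr (.inr ⟨p, hp⟩))⟩

end Generator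

/-! ## The system problem and its Lagrangian dual -/

variable {J : Type*} [Fintype J] {G : J → Generator} {T : ℕ} {d : Period T → ℝ}

theorem systemLP_cost_apply (x : J → Plan) : (systemLP G T d).cost x = totalCost G T x := by
  simp [systemLP, totalCost]

theorem mem_region_of_feasible {x : J → Plan} (hx : x ∈ (systemLP G T d).feasible) (j : J) :
    x j ∈ (G j).region T :=
  ⟨fun c => hx.1 ⟨j, c⟩, fun c => hx.2 (.inr ⟨j, c⟩)⟩

theorem sum_output_of_feasible {x : J → Plan} (hx : x ∈ (systemLP G T d).feasible)
    (s : Period T) : ∑ j, (G j).output T s (x j) = d s := by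
  simpa [systemLP] using hx.2 (.inl s)

theorem exists_isOptimal_systemLP (hfeas : (systemLP G T d).feasible.Nonempty) :
    ∃ x, (systemLP G T d).IsOptimal x := by
  refine (systemLP G T d).exists_isOptimal_of_recession hfeas fun x hi he => ?_
  rw [systemLP_cost_apply]
  exact sum_nonneg fun j _ => Generator.cost_nonneg (G := G j) (fun c => hi ⟨j, c⟩)
    fun c => he (.inr ⟨j, c⟩)

/-- The profits add up to the revenue minus the total cost. -/
theorem sum_profit_of_feasible (π : Period T → ℝ) {x : J → Plan}
    (hx : x ∈ (systemLP G T d).feasible) :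
    ∑ j, (G j).profit T π (x j) = ∑ s, π s * d s - totalCost G T x := by
  simp only [Generator.profit, totalCost, sum_sub_distrib]
  rw [sum_comm]
  simp only [← mul_sum, sum_output_of_feasible hx]

/-- Weak duality against the LP relaxation, not merely against binary schedules, thanks to
`Generator.profit_le_maxProfit`. -/
theorem lagrangianDual_le (π : Period T → ℝ) {x : J → Plan}
    (hx : x ∈ (systemLP G T d).feasible) : lagrangianDual G T d π ≤ totalCost G T x := by
  have h := sum_profit_of_feasible π hx
  have := sum_le_sum fun j (_ : j ∈ univ) =>
    Generator.profit_le_maxProfit π (mem_region_of_feasible hx j)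
  rw [lagrangianDual]
  linarith

/-- For a fixed schedule, uplift is the duality gap, so minimizing it over prices is maximizing the
Lagrangian dual. -/
theorem totalUplift_eq (π : Period T → ℝ) {x : J → Plan}
    (hx : x ∈ (systemLP G T d).feasible) :
    totalUplift G T π x = totalCost G T x - lagrangianDual G T d π := by
  rw [totalUplift, sum_sub_distrib, sum_profit_of_feasible π hx, lagrangianDual]
  ring

/-- The dual of the system problem decomposes into the duals of the generators' problems. -/
theorem dualFeasible_systemLP_iff {lam : (Σ j, (G j).Ineq T) → ℝ}
    {mu : Period T ⊕ (Σ j, (G j).Eqn T) → ℝ} :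
    (systemLP G T d).DualFeasible lam mu ↔
      ∀ j, ((G j).profitLP T fun s => mu (.inl s)).DualFeasible (fun c => lam ⟨j, c⟩)
        (fun c => mu (.inr ⟨j, c⟩)) := by
  classical
  have hsys : ∀ x : J → Plan, (∑ c, lam c • (systemLP G T d).ineq c
      + ∑ c, mu c • (systemLP G T d).eqn c) x = ∑ j, ((∑ c, lam ⟨j, c⟩ • (G j).ineq T c
        + ∑ c, mu (.inr ⟨j, c⟩) • (G j).eqn T c) (x j)
        + ∑ s, mu (.inl s) * (G j).output T s (x j)) := by
    intro x
    rw [Fintype.sum_sum_type, Fintype.sum_sigma, Fintype.sum_sigma]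
    simp only [systemLP, Sum.elim_inl, Sum.elim_inr, LinearMap.add_apply, LinearMap.sum_apply,
      LinearMap.smul_apply, LinearMap.comp_apply, LinearMap.proj_apply, smul_eq_mul,
      sum_add_distrib, mul_sum]
    rw [sum_comm (s := univ (α := Period T))]
    ring
  constructor
  · rintro ⟨hnn, hsum⟩ j
    refine ⟨fun c => hnn _, LinearMap.ext fun x => ?_⟩
    -- Evaluating where all other generators have the zero plan isolates the identity for `j`.
    have h := LinearMap.congr_fun hsum (Pi.single j x)
    rw [hsys, systemLP_cost_apply, totalCost, Fintype.sum_eq_single j, Fintype.sum_eq_single j]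
      at h
    · rw [Pi.single_eq_same] at h
      simp only [Generator.profitLP, LinearMap.sub_apply, LinearMap.sum_apply,
        LinearMap.smul_apply, smul_eq_mul] at h ⊢
      exact eq_sub_of_add_eq h
    · intro i hi
      rw [Pi.single_eq_of_ne hi, map_zero]
    · intro i hi
      simp [Pi.single_eq_of_ne hi]
  · intro h
    refine ⟨fun c => (h c.1).1 c.2, LinearMap.ext fun x => ?_⟩
    rw [hsys, systemLP_cost_apply, totalCost]
    refine sum_congr rfl fun j _ => ?_
    have hj := LinearMap.congr_fun (h j).2 (x j)
    simp only [Generator.profitLP, LinearMap.sub_apply, LinearMap.sum_apply,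
      LinearMap.smul_apply, smul_eq_mul] at hj ⊢
    exact eq_sub_iff_add_eq.1 hj

theorem dualObj_systemLP (lam : (Σ j, (G j).Ineq T) → ℝ)
    (mu : Period T ⊕ (Σ j, (G j).Eqn T) → ℝ) :
    (systemLP G T d).dualObj lam mu = ∑ s, mu (.inl s) * d s
      + ∑ j, ((G j).profitLP T fun s => mu (.inl s)).dualObj (fun c => lam ⟨j, c⟩)
        (fun c => mu (.inr ⟨j, c⟩)) := by
  simp only [LinProg.dualObj, systemLP, Generator.profitLP, Fintype.sum_sum_type,
    Fintype.sum_sigma, Sum.elim_inl, Sum.elim_inr, mul_zero, sum_const_zero, zero_add]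

/-- Weak duality generator by generator, each relaxed optimum being `-maxProfit`. -/
theorem dualObj_le_lagrangianDual (hfeas : (systemLP G T d).feasible.Nonempty)
    {lam : (Σ j, (G j).Ineq T) → ℝ} {mu : Period T ⊕ (Σ j, (G j).Eqn T) → ℝ}
    (h : (systemLP G T d).DualFeasible lam mu) :
    (systemLP G T d).dualObj lam mu ≤ lagrangianDual G T d fun s => mu (.inl s) := by
  obtain ⟨x, hx⟩ := hfeas
  rw [dualObj_systemLP, lagrangianDual, sub_eq_add_neg, ← sum_neg_distrib]
  gcongr with j
  obtain ⟨y, hy⟩ := Generator.exists_isOptimal_profitLP (fun s => mu (.inl s))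
    ⟨x j, mem_region_of_feasible hx j⟩
  rw [← Generator.cost_eq_neg_maxProfit _ hy]
  exact LinProg.weak_duality _ (dualFeasible_systemLP_iff.1 h j) hy.1

/-- Optimal dual solutions of the generators' problems at prices `π` are glued together, with `π` as
load-balance part. -/
theorem exists_dualFeasible_eq_lagrangianDual (hfeas : (systemLP G T d).feasible.Nonempty)
    (π : Period T → ℝ) : ∃ lam mu, (systemLP G T d).DualFeasible lam mu ∧
      (∀ s, mu (.inl s) = π s) ∧ (systemLP G T d).dualObj lam mu = lagrangianDual G T d π := by
  obtain ⟨x, hx⟩ := hfeas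
  have h : ∀ j, ∃ lam mu, ((G j).profitLP T π).DualFeasible lam mu ∧
      ((G j).profitLP T π).dualObj lam mu = -(G j).maxProfit T π := fun j => by
    obtain ⟨y, hy⟩ := Generator.exists_isOptimal_profitLP π ⟨x j, mem_region_of_feasible hx j⟩
    rw [← Generator.cost_eq_neg_maxProfit _ hy]
    exact LinProg.exists_dualFeasible_eq_cost _ hy
  choose lam mu hd hobj using h
  refine ⟨fun c => lam c.1 c.2, Sum.elim π fun c => mu c.1 c.2,
    dualFeasible_systemLP_iff.2 hd, fun s => rfl, ?_⟩
  rw [dualObj_systemLP, lagrangianDual, sub_eq_add_neg, ← sum_neg_distrib]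
  exact congrArg _ (sum_congr rfl fun j _ => hobj j)

theorem exists_isLoadBalanceDual (hfeas : (systemLP G T d).feasible.Nonempty) :
    ∃ π, IsLoadBalanceDual G T d π := by
  obtain ⟨x, hx⟩ := exists_isOptimal_systemLP hfeas
  obtain ⟨lam, mu, hd, hobj⟩ := LinProg.exists_dualFeasible_eq_cost _ hx
  exact ⟨fun s => mu (.inl s), lam, mu, LinProg.isDualOptimal_of_cost_le _ hx.1 hd hobj.ge,
    fun _ => rfl⟩

/-- The load-balance duals are the prices at which there is no duality gap. -/
theorem isLoadBalanceDual_iff_lagrangianDual_eq {x : J → Plan}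
    (hx : (systemLP G T d).IsOptimal x) (π : Period T → ℝ) :
    IsLoadBalanceDual G T d π ↔ lagrangianDual G T d π = totalCost G T x := by
  constructor
  · rintro ⟨lam, mu, hd, hπ⟩
    obtain rfl : (fun s => mu (.inl s)) = π := funext hπ
    refine le_antisymm (lagrangianDual_le _ hx.1) ?_
    rw [← systemLP_cost_apply (d := d), ← hd.dualObj_eq hx]
    exact dualObj_le_lagrangianDual ⟨x, hx.1⟩ hd.1
  · intro h
    obtain ⟨lam, mu, hd, hπ, hobj⟩ := exists_dualFeasible_eq_lagrangianDual ⟨x, hx.1⟩ π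
    refine ⟨lam, mu, LinProg.isDualOptimal_of_cost_le _ hx.1 hd ?_, hπ⟩
    rw [systemLP_cost_apply, hobj, h]

/-- The LP value bounds the Lagrangian dual from above, and a load-balance dual attains it. -/
theorem isConvexHullPrice_iff_lagrangianDual_eq {x : J → Plan}
    (hx : (systemLP G T d).IsOptimal x) (π : Period T → ℝ) :
    IsConvexHullPrice G T d π ↔ lagrangianDual G T d π = totalCost G T x := by
  constructor
  · intro h
    obtain ⟨π', hπ'⟩ := exists_isLoadBalanceDual ⟨x, hx.1⟩
    rw [isLoadBalanceDual_iff_lagrangianDual_eq hx] at hπ'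
    exact le_antisymm (lagrangianDual_le _ hx.1) (hπ' ▸ h π')
  · intro h π'
    rw [h]
    exact lagrangianDual_le _ hx.1

theorem minimizesUplift_iff {x : J → Plan} (hx : x ∈ (systemLP G T d).feasible)
    (π : Period T → ℝ) : MinimizesUplift G T x π ↔ IsConvexHullPrice G T d π := by
  simp only [MinimizesUplift, IsConvexHullPrice, totalUplift_eq _ hx, sub_le_sub_iff_left]

/-- The LP relaxation bounds the cost below, and only finitely many binary patterns occur. -/
theorem exists_isOptimalSchedule (hne : (schedules G T d).Nonempty) :
    ∃ x, IsOptimalSchedule G T d x := by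
  have hbin : ∀ x : J → Plan, (∀ j, (G j).IsBinary T (x j)) ↔
      ∀ i : Σ j, Icc (G j).t₀ T ⊕ (G j).laterOn T ⊕ (G j).offIntervals T,
        (coord ((G i.1).binaryVar T i.2) ∘ₗ LinearMap.proj i.1) x = 0 ∨
        (coord ((G i.1).binaryVar T i.2) ∘ₗ LinearMap.proj i.1) x = 1 := by
    intro x
    simp only [Generator.isBinary_iff, Sigma.forall, LinearMap.comp_apply, LinearMap.proj_apply]
  obtain ⟨x₀, hx₀, hbin₀⟩ := hne
  obtain ⟨x', hx'⟩ := exists_isOptimal_systemLP ⟨x₀, hx₀⟩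
  obtain ⟨x, hx, hxb, hmin⟩ := (systemLP G T d).exists_isOptimal_binary _
    ⟨x₀, hx₀, (hbin x₀).1 hbin₀⟩ hx'.2
  refine ⟨x, ⟨hx, (hbin x).2 hxb⟩, fun y hy => ?_⟩
  rw [← systemLP_cost_apply (d := d), ← systemLP_cost_apply (d := d)]
  exact hmin y hy.1 ((hbin y).1 hy.2)

end UnitCommitment

end

/-! ### Convex hull prices as load-balance duals -/

open UnitCommitment in
theorem theorem3 {J : Type*} [Fintype J] (G : J → Generator) (T : ℕ) (d : Period T → ℝ)
    (hfeas : (systemLP G T d).feasible.Nonempty) :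
    -- the linear program, its dual and the generators' problems have optimal solutions
    (∃ x, (systemLP G T d).IsOptimal x) ∧
    (∃ π, IsLoadBalanceDual G T d π) ∧
    (∀ j π, IsGreatest ((G j).profits T π) ((G j).maxProfit T π)) ∧
    -- the optimal convex hull prices are the dual values of the load-balance constraints
    (∀ π, IsConvexHullPrice G T d π ↔ IsLoadBalanceDual G T d π) ∧
    (∀ x π, (systemLP G T d).IsOptimal x → IsConvexHullPrice G T d π →
      lagrangianDual G T d π = totalCost G T x) ∧
    -- they are the minimizers of the total uplift for each optimal schedule
    ((schedules G T d).Nonempty → ∃ xbar, IsOptimalSchedule G T d xbar) ∧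
    (∀ xbar, IsOptimalSchedule G T d xbar →
      (∀ π, MinimizesUplift G T xbar π ↔ IsLoadBalanceDual G T d π) ∧
      (∀ x π, (systemLP G T d).IsOptimal x → MinimizesUplift G T xbar π →
        totalUplift G T π xbar = totalCost G T xbar - totalCost G T x)) := by
  obtain ⟨x₀, hx₀⟩ := hfeas
  obtain ⟨x, hx⟩ := exists_isOptimal_systemLP ⟨x₀, hx₀⟩
  have hiff : ∀ π, IsConvexHullPrice G T d π ↔ IsLoadBalanceDual G T d π := fun π => by
    rw [isConvexHullPrice_iff_lagrangianDual_eq hx, isLoadBalanceDual_iff_lagrangianDual_eq hx]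
  refine ⟨⟨x, hx⟩, exists_isLoadBalanceDual ⟨x₀, hx₀⟩, fun j π =>
    Generator.isGreatest_maxProfit π ⟨x₀ j, mem_region_of_feasible hx₀ j⟩, hiff,
    fun y π hy => (isConvexHullPrice_iff_lagrangianDual_eq hy π).1, exists_isOptimalSchedule,
    fun xbar hbar => ⟨fun π => (minimizesUplift_iff hbar.1.1 π).trans (hiff π),
      fun y π hy hπ => ?_⟩⟩
  rw [minimizesUplift_iff hbar.1.1, isConvexHullPrice_iff_lagrangianDual_eq hy] at hπ
  rw [totalUplift_eq π hbar.1.1, hπ]
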